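/- **Theorem 1.** Consider a distribution grid with a finite set $\mathcal M$ of buses, one of which is the slack bus. Let $y_{ik}=y_{ki}\in\mathbb C$ be the admittance of the branch between buses $i\ne k$ (with $y_{ik}=0$ if there is no branch) and $b_i\in\mathbb C$ the shunt admittance at bus $i$. Let $Y$ be the nodal admittance matrix, with entries $Y_{ik}=-y_{ik}$ for $i\neq k$ and $Y_{ii}=\sum_{k\ne i}y_{ik}+\tfrac12 b_i$. Let $\Delta V=(\Delta V_i)_{i\in\mathcal M}$ and $\Delta I=(\Delta I_i)_{i\in\mathcal M}$ be the complex random vectors of voltage increments and current-injection increments, defined on a standard Borel probability space. Assume that, almost surely, $\Delta V=0$ at the slack bus and $Y\,\Delta V=\Delta I$. Assume also that the increments $\Delta I_i$ of the non-slack buses are (mutually) independent and that each of them is Gaussian (as a random vector in $\mathbb C\cong\mathbb R^2$, possibly with a degenerate covariance) with mean zero and nonzero variance $\mathbb E|\Delta I_i|^2>0$. Let $\mathcal N(i)=\{k\neq i: y_{ik}\ne 0\}$ be the set of neighbours of $i$, let $\mathcal N^2(i)$ be the set of buses $k\ne i$ adjacent to some neighbour of $i$, and put $S_i=\mathcal N(i)\cup\mathcal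 N^2(i)$. Then for every bus $i$ the following hold. 1. $\Delta V_i$ is conditionally independent of the random vector $(\Delta V_k)_{k\notin\{i\}\cup S_i}$ given $(\Delta V_q)_{q\in S_i}$. 2. Consequently, the conditional law of $\Delta V_i$ given the increments at all other buses depends only on those in $S_i$: for every Borel set $A\subseteq\mathbb C$, almost surely $$P\big(\Delta V_i\in A\,\big|\,(\Delta V_k)_{k\ne i}\big)=P\big(\Delta V_i\in A\,\big|\,(\Delta V_q)_{q\in S_i}\big).$$ Both statements also hold if $\mathcal N(i)$ and $\mathcal N^2(i)$ are formed after deleting all branches at the slack bus, so that hops to or through the slack bus are not counted. -/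

import Mathlib

open MeasureTheory ProbabilityTheory

/-- A distribution grid on a finite set `B` of buses with a distinguished slack bus.
`y i k` (for `i ≠ k`) is the admittance of the branch between the buses `i` and `k`, with
`y i k = 0` when there is no such branch; the values `y i i` are never used.
`b i` is the shunt admittance at bus `i`. -/
structure DistributionGrid (B : Type*) where
  /-- the slack bus -/
  slack : B
  /-- the branch admittances -/
  y : B → B → ℂ
  /-- the shunt admittances -/
  b : B → ℂ
  y_symm : ∀ i k, y i k = y k i

namespace DistributionGrid

variable {B : Type*}

/-- The nodal admittance matrix: `-y i k` off the diagonal, and the sum of the admittances of the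
branches at `i` plus half the shunt admittance on the diagonal. -/
noncomputable def admittance [Fintype B] [DecidableEq B] (grid : DistributionGrid B) :
    Matrix B B ℂ :=
  Matrix.of fun i k =>
    if i = k then (∑ l ∈ Finset.univ.erase i, grid.y i l) + grid.b i / 2 else -grid.y i k

/-- The branch graph: distinct buses are adjacent when the branch between them has nonzero
admittance. -/
def graph (grid : DistributionGrid B) : SimpleGraph B where
  Adj i k := i ≠ k ∧ grid.y i k ≠ 0
  symm := ⟨fun i k h => ⟨h.1.symm, by rw [grid.y_symm k i]; exact h.2⟩⟩
  loopless := ⟨fun _ h => h.1 rfl⟩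

/-- The branch graph without the branches at the slack bus, so that no path runs through it. -/
def nonSlackGraph (grid : DistributionGrid B) : SimpleGraph B where
  Adj i k := grid.graph.Adj i k ∧ i ≠ grid.slack ∧ k ≠ grid.slack
  symm := ⟨fun _ _ h => ⟨h.1.symm, h.2.2, h.2.1⟩⟩
  loopless := ⟨fun _ h => h.1.1 rfl⟩

end DistributionGrid

/-- The two-hop neighbours of `i`: the buses other than `i` adjacent to a neighbour of `i`. -/
def twoHop {B : Type*} (G : SimpleGraph B) (i : B) : Set B :=
  {k | k ≠ i ∧ ∃ l ∈ G.neighborSet i, G.Adj k l}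

/-- The neighbours together with the two-hop neighbours of `i`. -/
def hopNbhd {B : Type*} (G : SimpleGraph B) (i : B) : Set B :=
  G.neighborSet i ∪ twoHop G i

/-- The random vector of the voltage increments of the buses in `S`. -/
def increments {B Ω : Type*} (ΔV : B → Ω → ℂ) (S : Set B) : Ω → (S → ℂ) :=
  fun ω k => ΔV k ω

theorem measurable_increments {B Ω : Type*} [MeasurableSpace Ω] {ΔV : B → Ω → ℂ}
    (hV : ∀ i, Measurable (ΔV i)) (S : Set B) : Measurable (increments ΔV S) :=
  measurable_pi_lambda _ fun k => hV k

/-- The σ-algebra generated by the voltage increments of the buses in `S`. -/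
noncomputable abbrev incrementsSigma {B Ω : Type*} (ΔV : B → Ω → ℂ) (S : Set B) : MeasurableSpace Ω :=
  MeasurableSpace.comap (increments ΔV S) inferInstance

theorem incrementsSigma_le {B Ω : Type*} [mΩ : MeasurableSpace Ω] {ΔV : B → Ω → ℂ}
    (hV : ∀ i, Measurable (ΔV i)) (S : Set B) : incrementsSigma ΔV S ≤ mΩ :=
  (measurable_increments hV S).comap_le

/-!
The result is the local Markov property of a linear system with independent sources;
Gaussian laws supply the square integrability.

Replacing the slack row and column of the admittance matrix by those of the identity gives a matrix
`M` whose off-diagonal support is the branch graph without the branches at the slack bus, and the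
entries of `M ΔV` are almost surely the injections of the non-slack buses, and `0` at the slack bus.
They are independent. A left kernel vector of `M` would be a linear relation between them, and since
independent centred variables are orthogonal and the injections have nonzero variance, there is none
(`eq_zero_of_sum_mul_ae_eq_zero`): `M` is invertible.

Fix a bus `i` and a set `S` that does not contain `i` but contains its neighbours and two-hop
neighbours, let `J` be the set of rows of `M` that involve `ΔV i`, and split `ΔV = a + c` into the
parts caused by the sources in `J` and off `J`. These parts are independent. The rows in `J` vanish
off `S ∪ {i}`, because a bus that meets such a row is within two hops of `i`. Hence `a` is
`ΔV i` at the coordinate `i` plus a linear function of `ΔV` on `S` (`sourcePart_mulVec_mulVec`).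
Three consequences follow: knowing `ΔV` on `S` is the same as knowing both `a` and `c` on `S`; given
`ΔV` on `S`, the variable `ΔV i` is a function of `a`; and the increments off `S ∪ {i}` are,
again given `ΔV` on `S`, functions of `c`. Independent
variables stay independent when a function of each is revealed
(`IndepFun.condIndepFun_comp_prodMk`), which gives the conditional independence
(`condIndepFun_increments_of_iIndepFun_mulVec`). Since only `hopNbhd` of the smaller graph has to lie
in `S`, one argument serves both graphs and also the slack bus itself. The second assertion
is the description of conditional independence by conditional probabilities
(`CondIndepFun.condExp_preimage_eq`).
-/

/-! ### Conditional independence -/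

section CondIndep

variable {Ω α β γ : Type*} {m' m'' : MeasurableSpace Ω} [mΩ : MeasurableSpace Ω]
  [StandardBorelSpace Ω] {μ : Measure Ω} [IsFiniteMeasure μ]
  [mα : MeasurableSpace α] [mβ : MeasurableSpace β] [mγ : MeasurableSpace γ]

/-- If conditioning on a σ-algebra `m''`, which contains `m'` and makes `f` measurable, tells no
more about `g` than conditioning on `m'`, then `f` and `g` are conditionally independent
given `m'`. -/
theorem condIndepFun_of_condExp_preimage_eq {f : Ω → α} {g : Ω → β}
    (hm' : m' ≤ mΩ) (hm'' : m'' ≤ mΩ) (hm : m' ≤ m'') (hf : Measurable[m''] f)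
    (hg : Measurable g)
    (h : ∀ t, MeasurableSet t → μ⟦g ⁻¹' t | m''⟧ =ᵐ[μ] μ⟦g ⁻¹' t | m'⟧) :
    CondIndepFun m' hm' f g μ := by
  have hfΩ : Measurable f := hf.mono hm'' le_rfl
  rw [condIndepFun_iff_condExp_inter_preimage_eq_mul hfΩ hg]
  intro s t hs ht
  set a : Ω → ℝ := (f ⁻¹' s).indicator fun _ => 1
  set c : Ω → ℝ := (g ⁻¹' t).indicator fun _ => 1
  have hac : (f ⁻¹' s ∩ g ⁻¹' t).indicator (fun _ => (1 : ℝ)) = a * c :=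
    Set.inter_indicator_one
  have hai : Integrable a μ := (integrable_const 1).indicator (hfΩ hs)
  have hci : Integrable c μ := (integrable_const 1).indicator (hg ht)
  have haci : Integrable (a * c) μ := by
    rw [← hac]; exact (integrable_const 1).indicator ((hfΩ hs).inter (hg ht))
  have ham : StronglyMeasurable[m''] a := stronglyMeasurable_const.indicator (hf hs)
  have hpull : μ[a * c | m''] =ᵐ[μ] a * μ[c | m'] :=
    (condExp_mul_of_stronglyMeasurable_left ham haci hci).trans
      ((Filter.EventuallyEq.refl _ a).mul (h t ht))
  have hint : Integrable (a * μ[c | m']) μ := integrable_condExp.congr hpull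
  rw [hac]
  calc μ[a * c | m'] =ᵐ[μ] μ[μ[a * c | m''] | m'] := (condExp_condExp_of_le hm hm'').symm
    _ =ᵐ[μ] μ[a * μ[c | m'] | m'] := condExp_congr_ae hpull
    _ =ᵐ[μ] μ[a | m'] * μ[c | m'] :=
      condExp_mul_of_stronglyMeasurable_right stronglyMeasurable_condExp hint hai

variable [StandardBorelSpace α] [Nonempty α] [StandardBorelSpace β] [Nonempty β]

/-- If `f` and `g` are conditionally independent given `k`, revealing `f` on top of `k` does not
change the conditional probabilities of events about `g`. -/
theorem ProbabilityTheory.CondIndepFun.condExp_preimage_eq {f : Ω → α} {g : Ω → β} {k : Ω → γ}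
    (hf : Measurable f) (hg : Measurable g) (hk : Measurable k)
    (h : CondIndepFun (mγ.comap k) hk.comap_le f g μ) {t : Set β} (ht : MeasurableSet t) :
    μ⟦g ⁻¹' t | MeasurableSpace.comap (fun ω => (k ω, f ω)) inferInstance⟧ =ᵐ[μ]
      μ⟦g ⁻¹' t | mγ.comap k⟧ := by
  have hkf : Measurable fun ω => (k ω, f ω) := hk.prodMk hf
  have h1 := ae_of_ae_map hkf.aemeasurable
    ((condIndepFun_iff_condDistrib_prod_ae_eq_prodMkRight hg hf hk).1 h)
  refine (condDistrib_ae_eq_condExp hkf hg ht).symm.trans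
    (Filter.EventuallyEq.trans ?_ (condDistrib_ae_eq_condExp hk hg ht))
  filter_upwards [h1] with ω hω
  rw [hω, Kernel.prodMkRight_apply]

/-- Conditional independence of `f` and `g` given `k` survives when `f` is replaced by a function
of `f` and `k`. -/
theorem ProbabilityTheory.CondIndepFun.comp_prodMk_left {δ : Type*} [MeasurableSpace δ]
    {f : Ω → α} {g : Ω → β} {k : Ω → γ}
    (hf : Measurable f) (hg : Measurable g) (hk : Measurable k)
    (h : CondIndepFun (mγ.comap k) hk.comap_le f g μ) {φ : γ × α → δ} (hφ : Measurable φ) :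
    CondIndepFun (mγ.comap k) hk.comap_le (fun ω => φ (k ω, f ω)) g μ := by
  refine condIndepFun_of_condExp_preimage_eq hk.comap_le (hk.prodMk hf).comap_le ?_
    (hφ.comp (comap_measurable _)) hg fun t ht => h.condExp_preimage_eq hf hg hk ht
  exact (measurable_fst.comp (comap_measurable fun ω => (k ω, f ω))).comap_le

/-- Independent variables remain independent when a function of each of them is revealed. -/
theorem ProbabilityTheory.IndepFun.condIndepFun_comp_prodMk [IsProbabilityMeasure μ]
    {δ : Type*} [mδ : MeasurableSpace δ]
    {f : Ω → α} {g : Ω → β} (hf : Measurable f) (hg : Measurable g)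
    (h : IndepFun f g μ) {p : α → γ} {q : β → δ} (hp : Measurable p) (hq : Measurable q) :
    CondIndepFun (MeasurableSpace.comap (fun ω => (p (f ω), q (g ω))) inferInstance)
      ((hp.comp hf).prodMk (hq.comp hg)).comap_le f g μ := by
  have hqg : Measurable fun ω => q (g ω) := hq.comp hg
  have hle : mδ.comap (fun ω => q (g ω)) ≤ mβ.comap g := (hq.comp (comap_measurable g)).comap_le
  -- revealing `q ∘ g` alone: both conditional laws of `f` are its unconditional law
  have h1 : CondIndepFun (mδ.comap fun ω => q (g ω)) hqg.comap_le g f μ := by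
    refine condIndepFun_of_condExp_preimage_eq hqg.comap_le hg.comap_le hle (comap_measurable g)
      hf fun t ht => ?_
    have hs : StronglyMeasurable[mα.comap f] ((f ⁻¹' t).indicator fun _ => (1 : ℝ)) :=
      stronglyMeasurable_const.indicator (comap_measurable f ht)
    exact (condExp_indep_eq hf.comap_le hg.comap_le hs h).trans
      (condExp_indep_eq hf.comap_le hqg.comap_le hs (indep_of_indep_of_le_right h hle)).symm
  -- revealing `p ∘ f` as well: `σ(p ∘ f, q ∘ g)` lies between `σ(q ∘ g)` and `σ(q ∘ g, f)`, and
  -- the conditional law of `g` is the same at both ends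
  have h2 := h1.symm
  have hm1 : mδ.comap (fun ω => q (g ω)) ≤
      MeasurableSpace.comap (fun ω => (p (f ω), q (g ω))) inferInstance :=
    (measurable_snd.comp (comap_measurable fun ω => (p (f ω), q (g ω)))).comap_le
  have hm2 : MeasurableSpace.comap (fun ω => (p (f ω), q (g ω))) inferInstance ≤
      MeasurableSpace.comap (fun ω => (q (g ω), f ω)) inferInstance := by
    have hφ : Measurable fun z : δ × α => (p z.2, z.1) := by fun_prop
    exact (hφ.comp (comap_measurable fun ω => (q (g ω), f ω))).comap_le
  refine condIndepFun_of_condExp_preimage_eq ((hp.comp hf).prodMk hqg).comap_le (hqg.prodMk hf).comap_le hm2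
    (measurable_snd.comp (comap_measurable fun ω => (q (g ω), f ω))) hg fun t ht => ?_
  have h3 := h2.condExp_preimage_eq hf hg hqg ht
  refine h3.trans ?_
  refine (Filter.EventuallyEq.trans (condExp_condExp_of_le hm2 (hqg.prodMk hf).comap_le).symm
    ((condExp_congr_ae h3).trans ?_)).symm
  exact (condExp_of_stronglyMeasurable ((hp.comp hf).prodMk hqg).comap_le
    (stronglyMeasurable_condExp.mono hm1) integrable_condExp).eventuallyEq

end CondIndep

/-! ### Networks driven by independent sources -/

section Network

open Matrix

variable {B : Type*}

/-- The extension by zero of a vector indexed by `S`. -/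
noncomputable def extendZero (S : Set B) (z : S → ℂ) : B → ℂ :=
  open scoped Classical in fun k => if h : k ∈ S then z ⟨k, h⟩ else 0

theorem measurable_extendZero (S : Set B) : Measurable (extendZero S) := by
  refine measurable_pi_lambda _ fun k => ?_
  unfold extendZero
  split_ifs with h
  · exact measurable_pi_apply _
  · exact measurable_const

variable [Fintype B] [DecidableEq B]

/-- The inverse system applied to the sources in `J` only: with `K = M⁻¹`, the matrix
`sourcePart K J` maps the source vector `M v` to the part of `v` that is caused by the sources
in `J`. -/
noncomputable def sourcePart (K : Matrix B B ℂ) (J : Finset B) : Matrix B B ℂ :=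
  K * diagonal fun j => if j ∈ J then 1 else 0

theorem sourcePart_mulVec (K : Matrix B B ℂ) (J : Finset B) (w : B → ℂ) :
    sourcePart K J *ᵥ w = K.submatrix id ((↑) : J → B) *ᵥ fun j => w j := by
  ext k
  rw [sourcePart, ← mulVec_mulVec]
  change ∑ x, K k x * (diagonal _ *ᵥ w) x = ∑ x : J, K k x * w x
  simp only [mulVec_diagonal, ite_mul, one_mul, zero_mul, mul_ite, mul_zero]
  rw [Finset.sum_ite_mem, Finset.univ_inter, ← Finset.sum_coe_sort]

theorem sourcePart_add_compl (K : Matrix B B ℂ) (J : Finset B) :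
    sourcePart K J + sourcePart K Jᶜ = K := by
  rw [sourcePart, sourcePart, ← mul_add, diagonal_add]
  convert mul_one K
  rw [← diagonal_one]
  congr 1
  ext j
  by_cases h : j ∈ J <;> simp [h]

/-- If the rows in `J` of `M` vanish off `S ∪ {i}`, and the other rows vanish at `i`, then the
sources in `J` cause exactly the coordinate `i` of `v`, up to a term that depends only on the
coordinates of `v` in `S`. -/
theorem sourcePart_mulVec_mulVec {K M : Matrix B B ℂ} (hKM : K * M = 1) {J : Finset B}
    {S : Set B} {i : B} (hi : i ∉ S) (hJ : ∀ j ∈ J, ∀ k ∉ S, k ≠ i → M j k = 0)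
    (hJc : ∀ j ∉ J, M j i = 0) (v : B → ℂ) :
    sourcePart K J *ᵥ (M *ᵥ v) =
      Pi.single i (v i) + (sourcePart K J * M) *ᵥ extendZero S fun k => v k := by
  have key : (diagonal fun j => if j ∈ J then (1 : ℂ) else 0) *ᵥ
      (M *ᵥ (v - extendZero S fun k => v k)) = M *ᵥ Pi.single i (v i) := by
    ext j
    rw [mulVec_diagonal, mulVec_single]
    simp only [mulVec, dotProduct, Pi.sub_apply]
    by_cases hj : j ∈ J
    · rw [if_pos hj, one_mul, Finset.sum_eq_single i]
      · simp [extendZero, hi]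
      · intro k _ hk
        by_cases hkS : k ∈ S
        · simp [extendZero, hkS]
        · rw [hJ j hj k hkS hk, zero_mul]
      · simp
    · simp [hj, hJc j hj]
  have h2 := congrArg (K *ᵥ ·) key
  simp only [mulVec_mulVec, ← mul_assoc, hKM, one_mulVec] at h2
  rw [← h2, sourcePart, mulVec_mulVec, mulVec_sub, sub_add_cancel]

/-- The local Markov property: the solution of an invertible linear system with independent
right-hand side is conditionally independent, at `i` and off `S ∪ {i}`, given its values on any
`S` that contains the two-hop neighbourhood of `i` in the graph of the system. -/
theorem condIndepFun_increments_of_iIndepFun_mulVec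
    {Ω : Type*} [MeasurableSpace Ω] [StandardBorelSpace Ω] {P : Measure Ω} [IsProbabilityMeasure P]
    {V : B → Ω → ℂ} (hV : ∀ i, Measurable (V i)) {M : Matrix B B ℂ} (hM : IsUnit M.det)
    (hind : iIndepFun (fun j ω => (M *ᵥ fun k => V k ω) j) P)
    {H : SimpleGraph B} (hH : ∀ j k, j ≠ k → M j k ≠ 0 → H.Adj j k)
    {S : Set B} {i : B} (hS : hopNbhd H i ⊆ S) (hi : i ∉ S) :
    CondIndepFun (incrementsSigma V S) (incrementsSigma_le hV S) (V i)
      (increments V ({i} ∪ S)ᶜ) P := by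
  classical
  set K := M⁻¹
  have hKM : K * M = 1 := nonsing_inv_mul M hM
  -- the sources that involve the coordinate `i`
  set J : Finset B := {j | M j i ≠ 0} with hJdef
  have hJc : ∀ j ∉ J, M j i = 0 := fun j hj => by simpa [hJdef] using hj
  have hJ : ∀ j ∈ J, ∀ k ∉ S, k ≠ i → M j k = 0 := by
    intro j hj k hkS hki
    have hji : M j i ≠ 0 := by simpa [hJdef] using hj
    by_contra hjk
    refine hkS (hS ?_)
    rcases eq_or_ne j i with rfl | hne
    · exact Or.inl (hH j k hki.symm hjk)
    · have hadj : H.Adj i j := (hH j i hne hji).symm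
      rcases eq_or_ne j k with rfl | hne'
      · exact Or.inl hadj
      · exact Or.inr ⟨hki, j, hadj, (hH j k hne' hjk).symm⟩
  have hmv : ∀ N : Matrix B B ℂ, Measurable fun w : B → ℂ => N *ᵥ w := fun N =>
    (Continuous.matrix_mulVec continuous_const continuous_id).measurable
  set N := sourcePart K J * M
  let X : Ω → B → ℂ := fun ω => M *ᵥ fun k => V k ω
  let a : Ω → B → ℂ := fun ω => sourcePart K J *ᵥ X ω
  let c : Ω → B → ℂ := fun ω => sourcePart K Jᶜ *ᵥ X ω
  let L : (S → ℂ) → B → ℂ := fun z => N *ᵥ extendZero S z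
  have hX : Measurable X := (hmv M).comp (measurable_pi_lambda _ hV)
  have ha : Measurable a := (hmv _).comp hX
  have hc : Measurable c := (hmv _).comp hX
  have hL : Measurable L := (hmv N).comp (measurable_extendZero S)
  have hac : IndepFun a c P := by
    have h := hind.indepFun_finset J Jᶜ disjoint_compl_right
      fun j => (measurable_pi_apply j).comp hX
    have hφ : ∀ I : Finset B,
        Measurable fun w : I → ℂ => K.submatrix id ((↑) : I → B) *ᵥ w := fun I =>
      (Continuous.matrix_mulVec continuous_const continuous_id).measurable
    have h' := h.comp (hφ J) (hφ Jᶜ)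
    convert h' using 1
    · exact funext fun ω => sourcePart_mulVec K J (X ω)
    · exact funext fun ω => sourcePart_mulVec K Jᶜ (X ω)
  have hZ : Measurable (increments V S) := measurable_increments hV S
  have haV : ∀ ω, a ω = Pi.single i (V i ω) + L (increments V S ω) := fun ω =>
    sourcePart_mulVec_mulVec hKM hi hJ hJc fun k => V k ω
  have hacV : ∀ ω k, a ω k + c ω k = V k ω := fun ω k => by
    have h : a ω + c ω = fun k => V k ω := by
      simp only [a, c, X]
      rw [← add_mulVec, sourcePart_add_compl, mulVec_mulVec, hKM, one_mulVec]
    exact congrFun h k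
  have haL : ∀ ω k, k ≠ i → a ω k = L (increments V S ω) k := fun ω k hk => by
    simp [haV, hk]
  -- revealing `V` on `S` amounts to revealing both parts of it
  let r : (B → ℂ) → S → ℂ := fun w k => w k
  have hr : Measurable r := measurable_pi_lambda _ fun k => measurable_pi_apply _
  have hσ : MeasurableSpace.comap (fun ω => (r (a ω), r (c ω))) inferInstance =
      incrementsSigma V S := by
    have hne : ∀ k : S, (k : B) ≠ i := fun k hk => hi (hk ▸ k.2)
    apply le_antisymm
    · have hφ : Measurable fun z : S → ℂ => (r (L z), z - r (L z)) := by fun_prop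
      have heq : (fun ω => (r (a ω), r (c ω))) =
          (fun z : S → ℂ => (r (L z), z - r (L z))) ∘ increments V S := by
        funext ω
        refine Prod.ext (funext fun k => haL ω k (hne k)) (funext fun k => ?_)
        simp only [r, Function.comp, Pi.sub_apply, increments, ← hacV ω k]
        exact eq_sub_of_add_eq' (congrArg (· + c ω k) (haL ω k (hne k)).symm)
      rw [heq]
      exact (hφ.comp (comap_measurable _)).comap_le
    · have hφ : Measurable fun z : (S → ℂ) × (S → ℂ) => z.1 + z.2 := by fun_prop
      have heq : increments V S = (fun z : (S → ℂ) × (S → ℂ) => z.1 + z.2) ∘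
          fun ω => (r (a ω), r (c ω)) := by
        funext ω k
        exact (hacV ω k).symm
      rw [incrementsSigma, heq]
      exact (hφ.comp (comap_measurable _)).comap_le
  have h1 : CondIndepFun (incrementsSigma V S) (incrementsSigma_le hV S) a c P := by
    have h := hac.condIndepFun_comp_prodMk ha hc hr hr
    convert h using 1
    exact hσ.symm
  have h2 : CondIndepFun (incrementsSigma V S) (incrementsSigma_le hV S) (V i) c P := by
    have hφ : Measurable fun z : (S → ℂ) × (B → ℂ) => z.2 i - L z.1 i := by fun_prop
    convert h1.comp_prodMk_left ha hc hZ hφ using 1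
    funext ω
    simp [haV]
  have hψ : Measurable fun (z : (S → ℂ) × (B → ℂ)) (k : (({i} ∪ S)ᶜ : Set B)) =>
      L z.1 k + z.2 k := by fun_prop
  convert (h2.symm.comp_prodMk_left hc (hV i) hZ hψ).symm using 1
  funext ω k
  have hk : (k : B) ≠ i := fun h => k.2 (Or.inl h)
  rw [← haL ω k hk, hacV]
  rfl

end Network

/-! ### Independent families -/

section Independent

variable {Ω ι : Type*} [MeasurableSpace Ω] {P : Measure Ω}

/-- An independent family stays independent when one almost surely constant variable joins it. -/
theorem iIndepFun_of_subtype_ne_of_ae_const [IsProbabilityMeasure P] {E : Type*} [MeasurableSpace E]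
    {X : ι → Ω → E} {a : ι} {c : E} (ha : ∀ᵐ ω ∂P, X a ω = c)
    (h : iIndepFun (fun i : {i // i ≠ a} => X i) P) : iIndepFun X P := by
  classical
  suffices h' : iIndepFun (Function.update X a fun _ => c) P by
    refine h'.congr fun i => ?_
    rcases eq_or_ne i a with rfl | hi
    · rw [Function.update_self]
      filter_upwards [ha] with ω hω using hω.symm
    · rw [Function.update_of_ne hi]
  rw [iIndepFun_iff_measure_inter_preimage_eq_mul] at h ⊢
  intro S s hs
  have herase : P (⋂ i ∈ S.erase a, X i ⁻¹' s i) = ∏ i ∈ S.erase a, P (X i ⁻¹' s i) := by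
    have h' := h (S.subtype (· ≠ a)) (sets := fun i => s i)
      fun i hi => hs i (Finset.mem_subtype.1 hi)
    rw [Finset.prod_subtype_eq_prod_filter (s := S) (p := (· ≠ a)) fun i => P (X i ⁻¹' s i),
      Finset.filter_ne'] at h'
    rw [← h']
    congr 1
    ext ω
    simp only [Set.mem_iInter, Finset.mem_erase, Finset.mem_subtype, Subtype.forall]
    exact ⟨fun H i hi hiS => H i ⟨hi, hiS⟩, fun H i hi => H i hi.1 hi.2⟩
  have hcongr : ∀ i ∈ S.erase a, Function.update X a (fun _ => c) i ⁻¹' s i = X i ⁻¹' s i :=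
    fun i hi => by rw [Function.update_of_ne (Finset.ne_of_mem_erase hi)]
  by_cases haS : a ∈ S
  · rw [← Finset.insert_erase haS, Finset.set_biInter_insert,
      Finset.prod_insert (Finset.notMem_erase a S), Finset.prod_congr rfl fun i hi =>
        congrArg P (hcongr i hi), Set.iInter₂_congr hcongr, Function.update_self]
    by_cases hc : c ∈ s a
    · rw [Set.preimage_const_of_mem hc, Set.univ_inter, measure_univ, one_mul, herase]
    · simp [Set.preimage_const_of_notMem hc]
  · rw [Finset.erase_eq_of_notMem haS] at herase hcongr
    rw [Finset.prod_congr rfl fun i hi => congrArg P (hcongr i hi), Set.iInter₂_congr hcongr,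
      herase]

/-- Independent centred square-integrable variables are orthogonal, so the coefficient of one with
nonzero variance is zero in any linear relation between them. -/
theorem eq_zero_of_sum_mul_ae_eq_zero [Fintype ι] {X : ι → Ω → ℂ} (h : iIndepFun X P)
    (hL : ∀ i, MemLp (X i) 2 P) (hmean : ∀ i, ∫ ω, X i ω ∂P = 0) {w : ι → ℂ}
    (hw : ∀ᵐ ω ∂P, ∑ i, w i * X i ω = 0) {j : ι} (hj : 0 < ∫ ω, ‖X j ω‖ ^ 2 ∂P) : w j = 0 := by
  classical
  have hstar : MemLp (fun ω => star (X j ω)) 2 P := (hL j).star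
  have hint : ∀ i, Integrable (fun ω => star (X j ω) * X i ω) P := fun i =>
    hstar.integrable_mul (hL i)
  have h0 : ∑ i, w i * ∫ ω, star (X j ω) * X i ω ∂P = 0 := by
    simp_rw [← integral_const_mul]
    rw [← integral_finsetSum _ fun i _ => (hint i).const_mul _]
    rw [← integral_zero Ω ℂ (μ := P)]
    refine integral_congr_ae ?_
    filter_upwards [hw] with ω hω
    calc ∑ i, w i * (star (X j ω) * X i ω) = star (X j ω) * ∑ i, w i * X i ω := by
          rw [Finset.mul_sum]; exact Finset.sum_congr rfl fun i _ => by ring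
      _ = 0 := by rw [hω, mul_zero]
  rw [Finset.sum_eq_single j] at h0
  · refine (mul_eq_zero.1 h0).resolve_right ?_
    have hsq : ∫ ω, star (X j ω) * X j ω ∂P = ((∫ ω, ‖X j ω‖ ^ 2 ∂P : ℝ) : ℂ) := by
      rw [← integral_complex_ofReal]
      refine integral_congr_ae (.of_forall fun ω => ?_)
      simpa using Complex.conj_mul' (X j ω)
    rw [hsq]
    exact_mod_cast hj.ne'
  · intro i _ hij
    have hind : IndepFun (fun ω => star (X j ω)) (X i) P :=
      (h.indepFun hij.symm).comp (φ := star) (ψ := id) continuous_star.measurable measurable_id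
    rw [hind.integral_fun_mul_eq_mul_integral hstar.1 (hL i).1, hmean i, mul_zero, mul_zero]
  · simp

end Independent

section Increments

variable {B Ω : Type*} {V : B → Ω → ℂ}

theorem measurable_incrementsSigma {S : Set B} {k : B} (hk : k ∈ S) :
    Measurable[incrementsSigma V S] (V k) :=
  (measurable_pi_apply (⟨k, hk⟩ : S)).comp (comap_measurable (increments V S))

theorem incrementsSigma_union (S T : Set B) :
    incrementsSigma V (S ∪ T) =
      MeasurableSpace.comap (fun ω => (increments V S ω, increments V T ω)) inferInstance := by
  apply le_antisymm
  · let _ : MeasurableSpace Ω :=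
      MeasurableSpace.comap (fun ω => (increments V S ω, increments V T ω)) inferInstance
    have hpair : Measurable fun ω => (increments V S ω, increments V T ω) := comap_measurable _
    refine (measurable_pi_lambda (increments V (S ∪ T)) fun k => ?_).comap_le
    rcases k.2 with hk | hk
    · exact (measurable_pi_apply (⟨k, hk⟩ : S)).comp hpair.fst
    · exact (measurable_pi_apply (⟨k, hk⟩ : T)).comp hpair.snd
  · let _ : MeasurableSpace Ω := incrementsSigma V (S ∪ T)
    have hS : Measurable (increments V S) :=
      measurable_pi_lambda _ fun k => measurable_incrementsSigma (Or.inl k.2)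
    have hT : Measurable (increments V T) :=
      measurable_pi_lambda _ fun k => measurable_incrementsSigma (Or.inr k.2)
    exact (hS.prodMk hT).comap_le

end Increments

/-! ### The grid with the slack bus grounded -/

namespace DistributionGrid

open Matrix

variable {B : Type*}

theorem nonSlackGraph_le_graph (grid : DistributionGrid B) : grid.nonSlackGraph ≤ grid.graph :=
  fun _ _ h => h.1

variable [Fintype B] [DecidableEq B] (grid : DistributionGrid B)

/-- The nodal admittance matrix with the row and the column of the slack bus replaced by those of
the identity. It acts like the nodal admittance matrix on voltages that vanish at the slack bus,
except that its slack coordinate returns the slack voltage. -/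
noncomputable def groundedAdmittance : Matrix B B ℂ :=
  Matrix.of fun i k =>
    if i = grid.slack ∨ k = grid.slack then (if i = k then 1 else 0) else grid.admittance i k

theorem nonSlackGraph_adj_of_groundedAdmittance_ne_zero {j k : B} (hjk : j ≠ k)
    (h : grid.groundedAdmittance j k ≠ 0) : grid.nonSlackGraph.Adj j k := by
  by_cases hs : j = grid.slack ∨ k = grid.slack
  · simp [groundedAdmittance, hs, hjk] at h
  · have hs' := not_or.1 hs
    refine ⟨⟨hjk, fun hy => h ?_⟩, hs'.1, hs'.2⟩
    simp [groundedAdmittance, admittance, hs, hjk, hy]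

theorem groundedAdmittance_mulVec_slack (v : B → ℂ) :
    (grid.groundedAdmittance *ᵥ v) grid.slack = v grid.slack := by
  simp [mulVec, dotProduct, groundedAdmittance]

theorem vecMul_groundedAdmittance_slack (w : B → ℂ) :
    (w ᵥ* grid.groundedAdmittance) grid.slack = w grid.slack := by
  simp [vecMul, dotProduct, groundedAdmittance]

theorem groundedAdmittance_mulVec_of_ne_slack {v : B → ℂ} (hv : v grid.slack = 0) {i : B}
    (hi : i ≠ grid.slack) :
    (grid.groundedAdmittance *ᵥ v) i = (grid.admittance *ᵥ v) i := by
  refine Finset.sum_congr rfl fun k _ => ?_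
  rcases eq_or_ne k grid.slack with rfl | hk
  · simp [hv]
  · simp [groundedAdmittance, hi, hk]

end DistributionGrid

theorem hopNbhd_mono {B : Type*} {G H : SimpleGraph B} (h : G ≤ H) (i : B) :
    hopNbhd G i ⊆ hopNbhd H i := by
  rintro k (hk | ⟨hki, l, hl, hkl⟩)
  · exact Or.inl (h hk)
  · exact Or.inr ⟨hki, l, h hl, h hkl⟩

theorem notMem_hopNbhd {B : Type*} (G : SimpleGraph B) (i : B) : i ∉ hopNbhd G i := by
  rintro (h | h)
  · exact G.loopless.irrefl i h
  · exact h.1 rfl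

theorem theorem1 {B : Type*} [Fintype B] [DecidableEq B] (grid : DistributionGrid B)
    {Ω : Type*} [MeasurableSpace Ω] [StandardBorelSpace Ω]
    (P : Measure Ω) [IsProbabilityMeasure P]
    (ΔV ΔI : B → Ω → ℂ)
    (hV : ∀ i, Measurable (ΔV i))
    (hslack : ∀ᵐ ω ∂P, ΔV grid.slack ω = 0)
    (hnodal : ∀ᵐ ω ∂P, grid.admittance.mulVec (fun k => ΔV k ω) = fun k => ΔI k ω)
    (hindep : iIndepFun (fun i : {i : B // i ≠ grid.slack} => ΔI i) P)
    (hgauss : ∀ i, i ≠ grid.slack → HasGaussianLaw (ΔI i) P)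
    (hmean : ∀ i, i ≠ grid.slack → ∫ ω, ΔI i ω ∂P = 0)
    (hvar : ∀ i, i ≠ grid.slack → 0 < ∫ ω, ‖ΔI i ω‖ ^ 2 ∂P) :
    ∀ G : SimpleGraph B, G = grid.graph ∨ G = grid.nonSlackGraph → ∀ i : B,
      CondIndepFun (incrementsSigma ΔV (hopNbhd G i)) (incrementsSigma_le hV (hopNbhd G i))
        (ΔV i) (increments ΔV ({i} ∪ hopNbhd G i)ᶜ) P ∧
      ∀ s : Set ℂ, MeasurableSet s →
        P⟦ΔV i ⁻¹' s | incrementsSigma ΔV {i}ᶜ⟧ =ᵐ[P]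
          P⟦ΔV i ⁻¹' s | incrementsSigma ΔV (hopNbhd G i)⟧ := by
  intro G hG i
  set M := grid.groundedAdmittance with hM
  let X : B → Ω → ℂ := fun j ω => (M.mulVec fun k => ΔV k ω) j
  have hX0 : X grid.slack =ᵐ[P] fun _ => 0 := by
    filter_upwards [hslack] with ω hω
    exact (grid.groundedAdmittance_mulVec_slack _).trans hω
  have hXI : ∀ j, j ≠ grid.slack → X j =ᵐ[P] ΔI j := fun j hj => by
    filter_upwards [hslack, hnodal] with ω hω hω'
    exact (grid.groundedAdmittance_mulVec_of_ne_slack hω hj).trans (congrFun hω' j)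
  have hind : iIndepFun X P :=
    iIndepFun_of_subtype_ne_of_ae_const hX0 (hindep.congr fun j => (hXI j j.2).symm)
  -- a left kernel vector of `M` is a linear relation between the injections
  have hdet : IsUnit M.det := by
    rw [isUnit_iff_ne_zero]
    intro hdet
    obtain ⟨w, hw0, hw⟩ := Matrix.exists_vecMul_eq_zero_iff.2 hdet
    refine hw0 (funext fun j => ?_)
    rcases eq_or_ne j grid.slack with rfl | hj
    · rw [← grid.vecMul_groundedAdmittance_slack w, ← hM, hw]
    refine eq_zero_of_sum_mul_ae_eq_zero (j := j) hind (fun k => ?_) (fun k => ?_)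
      (.of_forall fun ω => ?_) ?_
    · rcases eq_or_ne k grid.slack with rfl | hk
      · exact (memLp_const (0 : ℂ)).ae_eq hX0.symm
      · exact (hgauss k hk).memLp_two.ae_eq (hXI k hk).symm
    · rcases eq_or_ne k grid.slack with rfl | hk
      · simp [integral_congr_ae hX0]
      · rw [integral_congr_ae (hXI k hk), hmean k hk]
    · change w ⬝ᵥ (M.mulVec fun k => ΔV k ω) = 0
      rw [Matrix.dotProduct_mulVec, hw, zero_dotProduct]
    · exact (hvar j hj).trans_eq
        (integral_congr_ae ((hXI j hj).fun_comp fun z => ‖z‖ ^ 2)).symm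
  have hsub : hopNbhd grid.nonSlackGraph i ⊆ hopNbhd G i := by
    rcases hG with rfl | rfl
    · exact hopNbhd_mono grid.nonSlackGraph_le_graph i
    · exact subset_rfl
  have hcond := condIndepFun_increments_of_iIndepFun_mulVec hV hdet hind
    (fun j k => grid.nonSlackGraph_adj_of_groundedAdmittance_ne_zero) hsub (notMem_hopNbhd G i)
  refine ⟨hcond, fun s hs => ?_⟩
  set S := hopNbhd G i
  have hR := measurable_increments hV ({i} ∪ S)ᶜ
  have h := hcond.symm.condExp_preimage_eq hR (hV i) (measurable_increments hV S) hs
  have hS : ({i}ᶜ : Set B) = S ∪ ({i} ∪ S)ᶜ := by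
    ext k
    have hi : i ∉ S := notMem_hopNbhd G i
    by_cases hk : k = i
    · simp [hk, hi]
    · simp [hk, em]
  rw [hS, incrementsSigma_union]
  exact h
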